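/- Let $\mathcal H$ be the Hilbert space of one bosonic mode, with Fock basis $|0\rangle,|1\rangle,\dots$ and number operator $a^\dagger a|m\rangle=m|m\rangle$. For $\gamma>0$ let $$\mathcal N_\gamma(\rho)=\int_{-\infty}^{\infty}\frac{e^{-\theta^2/(2\gamma)}}{\sqrt{2\pi\gamma}}\,e^{-i\theta a^\dagger a}\,\rho\, e^{i\theta a^\dagger a}\,d\theta$$ be the bosonic dephasing channel, and let $$p_\gamma(\theta)=\frac{1}{\sqrt{2\pi\gamma}}\sum_{k\in\mathbb Z}e^{-(\theta+2\pi k)^2/(2\gamma)}$$ be the wrapped normal density. Let $\gamma_1,\gamma_2>0$, let $q_1,q_2\ge 0$ with $q_1+q_2=1$, and let $n$ be a natural number. Let $\mathcal P(\mathcal H^{\otimes n})$ be the set of pure states $|\psi\rangle\langle\psi|$, $\psi\in\mathcal H^{\otimes n}$, $\|\psi\|=1$ (no energy constraint), and let $\|A\|_1=\mathrm{Tr}\sqrt{A^\dagger A}$. Then $$\sup_{\rho\in\mathcal P(\mathcal H^{\otimes n})}\bigl\|q_1\mathcal N_{\gamma_1}^{\otimes n}(\rho)-q_2\mathcal N_{\gamma_2}^{\otimes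 n}(\rho)\bigr\|_1=\int_{[-\pi,\pi]^n}\Bigl|q_1\prod_{k=1}^n p_{\gamma_1}(\theta_k)-q_2\prod_{k=1}^n p_{\gamma_2}(\theta_k)\Bigr|\,d\theta_1\cdots d\theta_n .$$ -/

import Mathlib

open scoped ENNReal
open MeasureTheory

namespace Dephasing

noncomputable section

/-- The complex Hilbert space `ℓ²(ι)`. -/
def Space (ι : Type) : Type := lp (fun _ : ι => ℂ) 2

instance (ι : Type) : NormedAddCommGroup (Space ι) :=
  inferInstanceAs (NormedAddCommGroup (lp (fun _ : ι => ℂ) 2))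

instance (ι : Type) : InnerProductSpace ℂ (Space ι) :=
  inferInstanceAs (InnerProductSpace ℂ (lp (fun _ : ι => ℂ) 2))

instance (ι : Type) : CompleteSpace (Space ι) :=
  inferInstanceAs (CompleteSpace (lp (fun _ : ι => ℂ) 2))

/-- The standard orthonormal basis `(|i⟩)` of `ℓ²(ι)`. -/
def ket (ι : Type) : HilbertBasis ι ℂ (Space ι) :=
  HilbertBasis.ofRepr (LinearIsometryEquiv.refl ℂ (lp (fun _ : ι => ℂ) 2))

/-- One bosonic mode `𝓗`, with the Fock basis `|0⟩, |1⟩, |2⟩, …`. -/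
abbrev Mode : Type := Space ℕ

/-- The Hilbert space `𝓗^{⊗ n}` of `n` bosonic modes, with the product Fock basis
`|m₁, …, mₙ⟩ = |m₁⟩ ⊗ ⋯ ⊗ |mₙ⟩`; the product vector `ψ₁ ⊗ ⋯ ⊗ ψₙ` is the one with the
coordinates `∏ k, ψₖ(mₖ)`. -/
abbrev Modes (n : ℕ) : Type := Space (Fin n → ℕ)

section Hilbert

variable {ι : Type}

/-- The trace norm `‖A‖₁ = Tr √(A† A)` with values in `[0, ∞]`; it is finite exactly on the
trace-class operators. The trace of the positive operator `√(A† A)` is the sum of its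
diagonal matrix elements, which are nonnegative reals. -/
def traceNorm (A : Space ι →L[ℂ] Space ι) : ℝ≥0∞ :=
  ∑' i : ι, ENNReal.ofReal
    (inner ℂ (ket ι i) (CFC.sqrt (ContinuousLinearMap.adjoint A * A) (ket ι i))).re

/-- The pure states: the operators `|ψ⟩⟨ψ|` with a unit vector `ψ`. -/
def pureStates (ι : Type) : Set (Space ι →L[ℂ] Space ι) :=
  {ρ | ∃ ψ : Space ι, ‖ψ‖ = 1 ∧ ρ = InnerProductSpace.rankOne ℂ ψ ψ}

/-- Multiplication of the coordinates by the phases `e^{-i φ(i)}` keeps a sequence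
square-summable. -/
lemma memℓp_phase (φ : ι → ℝ) (f : lp (fun _ : ι => ℂ) 2) :
    Memℓp (fun i => Complex.exp (-(φ i : ℂ) * Complex.I) * f i) 2 := by
  have h := lp.memℓp f
  have h2 : 0 < (2 : ℝ≥0∞).toReal := by simp
  rw [memℓp_gen_iff h2] at h ⊢
  refine h.congr (fun i => ?_)
  have := Complex.norm_exp_ofReal_mul_I (-φ i)
  push_cast at this
  rw [norm_mul, this, one_mul]

/-- The unitary operator which is diagonal in the basis `|i⟩`, with `|i⟩ ↦ e^{-i φ(i)} |i⟩`. -/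
def phaseOp (φ : ι → ℝ) : Space ι →L[ℂ] Space ι :=
  LinearIsometry.toContinuousLinearMap
  { toFun := fun f => (ket ι).repr.symm
      ⟨fun i => Complex.exp (-(φ i : ℂ) * Complex.I) * (ket ι).repr f i,
        memℓp_phase φ ((ket ι).repr f)⟩
    map_add' := fun f g => by
      apply (ket ι).repr.injective
      ext i
      simp [mul_add]
      rfl
    map_smul' := fun c f => by
      apply (ket ι).repr.injective
      ext i
      simp [mul_left_comm]
    norm_map' := fun f => by
      have h2 : 0 < (2 : ℝ≥0∞).toReal := by simp
      refine ((ket ι).repr.symm.norm_map _).trans (Eq.trans ?_ ((ket ι).repr.norm_map f))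
      refine (lp.norm_eq_tsum_rpow h2 _).trans (Eq.trans ?_ (lp.norm_eq_tsum_rpow h2 _).symm)
      congr 1
      refine tsum_congr fun i => ?_
      have := Complex.norm_exp_ofReal_mul_I (-φ i)
      push_cast at this
      change ‖_ * _‖ ^ _ = _
      rw [norm_mul, this, one_mul] }

lemma repr_phaseOp (φ : ι → ℝ) (f : Space ι) (i : ι) :
    (ket ι).repr (phaseOp φ f) i = Complex.exp (-(φ i : ℂ) * Complex.I) * (ket ι).repr f i := by
  change (ket ι).repr ((ket ι).repr.symm _) i = _
  rw [LinearIsometryEquiv.apply_symm_apply]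

end Hilbert

/-- The density `p'_γ` of the centred normal distribution with variance `γ`. -/
def normalDensity (γ θ : ℝ) : ℝ :=
  1 / √(2 * Real.pi * γ) * Real.exp (-θ ^ 2 / (2 * γ))

/-- The wrapped normal density `p_γ`. -/
def wrappedNormal (γ θ : ℝ) : ℝ :=
  1 / √(2 * Real.pi * γ) * ∑' k : ℤ, Real.exp (-(θ + 2 * Real.pi * k) ^ 2 / (2 * γ))

/-- The unitary `e^{-i θ a†a}` of one mode, where `a†a |m⟩ = m |m⟩`. -/
def rotation (θ : ℝ) : Mode →L[ℂ] Mode := phaseOp fun m : ℕ => θ * m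

/-- The unitary `e^{-i θ₁ a†a} ⊗ ⋯ ⊗ e^{-i θₙ a†a}` of `n` modes. -/
def rotations {n : ℕ} (θ : Fin n → ℝ) : Modes n →L[ℂ] Modes n :=
  phaseOp fun m : Fin n → ℕ => ∑ k, θ k * m k

/-- The bosonic dephasing channel with rate `γ`,
`𝓝_γ(ρ) = ∫ p'_γ(θ) e^{-i θ a†a} ρ e^{i θ a†a} dθ` over the real line. -/
def dephasing (γ : ℝ) (ρ : Mode →L[ℂ] Mode) : Mode →L[ℂ] Mode :=
  ∫ θ : ℝ, (normalDensity γ θ : ℂ) •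
    (rotation θ ∘L ρ ∘L ContinuousLinearMap.adjoint (rotation θ))

/-- The tensor power `𝓝_γ^{⊗ n}` on the operators of `n` modes: every mode is rotated by its own
independent normal angle. -/
def dephasingPow (n : ℕ) (γ : ℝ) (ρ : Modes n →L[ℂ] Modes n) : Modes n →L[ℂ] Modes n :=
  ∫ θ : Fin n → ℝ, ((∏ k, normalDensity γ (θ k) : ℝ) : ℂ) •
    (rotations θ ∘L ρ ∘L ContinuousLinearMap.adjoint (rotations θ))

lemma norm_phaseOp {ι : Type} (φ : ι → ℝ) (f : Space ι) : ‖phaseOp φ f‖ = ‖f‖ := by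
  unfold phaseOp
  rw [LinearIsometry.coe_toContinuousLinearMap, LinearIsometry.norm_map]

lemma continuous_phaseOp {ι X : Type} [TopologicalSpace X] (φ : X → ι → ℝ)
    (hφ : ∀ i, Continuous fun x => φ x i) (f : Space ι) : Continuous fun x => phaseOp (φ x) f := by
  classical
  have hb : ∀ i x, phaseOp (φ x) (ket ι i) = Complex.exp (-(φ x i : ℂ) * Complex.I) • ket ι i := by
    intro i x
    apply (ket ι).repr.injective
    ext j
    rw [repr_phaseOp, map_smul, HilbertBasis.repr_self]
    by_cases h : j = i
    · subst h; simp
    · simp [h]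
  have hs := (ket ι).hasSum_repr f
  refine TendstoUniformly.continuous (F := fun (s : Finset ι) x =>
    phaseOp (φ x) (∑ i ∈ s, (ket ι).repr f i • ket ι i)) (p := Filter.atTop) ?_ ?_
  · rw [Metric.tendstoUniformly_iff]
    intro ε hε
    filter_upwards [Metric.tendsto_nhds.1 hs ε hε] with s hs x
    rw [dist_eq_norm, ← map_sub, norm_phaseOp, ← dist_eq_norm, dist_comm]
    exact hs
  · refine Filter.Frequently.of_forall fun s => ?_
    simp only [map_sum, map_smul, hb]
    fun_prop

lemma continuous_rankOne {E X : Type*} [NormedAddCommGroup E] [InnerProductSpace ℂ E] [TopologicalSpace X] (f g : X → E) (hx : Continuous f) (hy : Continuous g) : Continuous fun t => InnerProductSpace.rankOne ℂ (f t) (g t) := by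
  rw [continuous_iff_continuousAt]
  intro t
  rw [ContinuousAt, tendsto_iff_norm_sub_tendsto_zero]
  have : ∀ s, InnerProductSpace.rankOne ℂ (f s) (g s) - InnerProductSpace.rankOne ℂ (f t) (g t) = InnerProductSpace.rankOne ℂ (f s - f t) (g s) + InnerProductSpace.rankOne ℂ (f t) (g s - g t) := by
    intro s; simp
  simp only [this]
  refine squeeze_zero (fun _ => norm_nonneg _) (fun s => (norm_add_le _ _)) ?_
  simp only [InnerProductSpace.norm_rankOne]
  have : Continuous fun s => ‖f s - f t‖ * ‖g s‖ + ‖f t‖ * ‖g s - g t‖ := by fun_prop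
  simpa using this.tendsto t

lemma mix_entry {ι X : Type} [TopologicalSpace X] [MeasurableSpace X] [BorelSpace X]
    [SecondCountableTopologyEither X (Space ι →L[ℂ] Space ι)]
    (μ : Measure X) (φ : X → ι → ℝ)
    (hφ : ∀ i, Continuous fun x => φ x i) (w : X → ℝ) (hw : Integrable w μ)
    (x y : Space ι) (i j : ι) :
    inner ℂ (ket ι i) ((∫ t, (w t : ℂ) • (phaseOp (φ t) ∘L InnerProductSpace.rankOne ℂ x y ∘L
      ContinuousLinearMap.adjoint (phaseOp (φ t))) ∂μ) (ket ι j)) =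
    (∫ t, (w t : ℂ) * Complex.exp (((φ t j - φ t i : ℝ) : ℂ) * Complex.I) ∂μ) *
      ((ket ι).repr x i * starRingEnd ℂ ((ket ι).repr y j)) := by
  have h1 : ∀ t, phaseOp (φ t) ∘L InnerProductSpace.rankOne ℂ x y ∘L
      ContinuousLinearMap.adjoint (phaseOp (φ t)) =
      InnerProductSpace.rankOne ℂ (phaseOp (φ t) x) (phaseOp (φ t) y) := by
    intro t
    rw [InnerProductSpace.rankOne_comp, InnerProductSpace.comp_rankOne]
    simp
  simp only [h1]
  have hc : Continuous fun t => InnerProductSpace.rankOne ℂ (phaseOp (φ t) x) (phaseOp (φ t) y) := by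
    have hx := continuous_phaseOp φ hφ x
    have hy := continuous_phaseOp φ hφ y
    exact continuous_rankOne _ _ hx hy
  have hI : Integrable (fun t => (w t : ℂ) •
      InnerProductSpace.rankOne ℂ (phaseOp (φ t) x) (phaseOp (φ t) y)) μ := by
    refine Integrable.mono' (hw.norm.mul_const (‖x‖ * ‖y‖)) ?_ ?_
    · exact (Complex.continuous_ofReal.comp_aestronglyMeasurable hw.aestronglyMeasurable).smul
        hc.aestronglyMeasurable
    · refine Filter.Eventually.of_forall fun t => ?_
      rw [norm_smul, InnerProductSpace.norm_rankOne, norm_phaseOp, norm_phaseOp]; simp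
  rw [ContinuousLinearMap.integral_apply hI, ← integral_inner (hI.apply_continuousLinearMap _), ← integral_mul_const]
  congr 1
  ext t
  have e1 : inner ℂ (ket ι i) (phaseOp (φ t) x) = Complex.exp (-(φ t i : ℂ) * Complex.I) * (ket ι).repr x i := by
    rw [← repr_phaseOp, HilbertBasis.repr_apply_apply]
  have e2 : inner ℂ (phaseOp (φ t) y) (ket ι j) = starRingEnd ℂ (Complex.exp (-(φ t j : ℂ) * Complex.I) * (ket ι).repr y j) := by
    rw [← repr_phaseOp, HilbertBasis.repr_apply_apply, inner_conj_symm]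
  simp only [_root_.smul_apply, InnerProductSpace.rankOne_apply, inner_smul_right, e1, e2]
  rw [map_mul, ← Complex.exp_conj]
  simp only [map_mul, map_neg, Complex.conj_ofReal, Complex.conj_I]
  have : Complex.exp (((φ t j - φ t i : ℝ) : ℂ) * Complex.I) = Complex.exp (-(φ t j:ℂ) * -Complex.I) * Complex.exp (-(φ t i : ℂ) * Complex.I) := by
    rw [← Complex.exp_add]; congr 1; push_cast; ring
  rw [this]; ring

lemma integrable_normalDensity {γ : ℝ} (hγ : 0 < γ) : Integrable (normalDensity γ) := by
  unfold normalDensity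
  refine Integrable.const_mul ?_ _
  have := integrable_exp_neg_mul_sq (b := 1 / (2 * γ)) (by positivity)
  refine this.congr (Filter.Eventually.of_forall fun x => ?_)
  simp only; congr 1; field_simp

/-- `𝓝_γ^{⊗ n}` is the tensor power of `𝓝_γ`: on the product operators
`|x₁⟩⟨y₁| ⊗ ⋯ ⊗ |xₙ⟩⟨yₙ|` it acts as `𝓝_γ(|x₁⟩⟨y₁|) ⊗ ⋯ ⊗ 𝓝_γ(|xₙ⟩⟨yₙ|)`. -/
theorem dephasingPow_tprod (n : ℕ) {γ : ℝ} (hγ : 0 < γ) (x y : Fin n → Mode) (X Y : Modes n)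
    (hX : ∀ m, (ket _).repr X m = ∏ k, (ket _).repr (x k) (m k))
    (hY : ∀ m, (ket _).repr Y m = ∏ k, (ket _).repr (y k) (m k)) (i j : Fin n → ℕ) :
    inner ℂ (ket _ i) (dephasingPow n γ (InnerProductSpace.rankOne ℂ X Y) (ket _ j)) =
    ∏ k, inner ℂ (ket _ (i k))
      (dephasing γ (InnerProductSpace.rankOne ℂ (x k) (y k)) (ket _ (j k))) := by
  unfold dephasingPow dephasing rotations rotation
  rw [mix_entry volume (fun (θ : Fin n → ℝ) (m : Fin n → ℕ) => ∑ k, θ k * m k) (by intro i; fun_prop)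
    (fun θ => ∏ k, normalDensity γ (θ k))
    (Integrable.fintype_prod (fun _ => integrable_normalDensity hγ))]
  simp_rw [mix_entry volume (fun (θ : ℝ) (m : ℕ) => θ * m) (by intro i; fun_prop)
    (fun θ => normalDensity γ θ) (integrable_normalDensity hγ)]
  rw [Finset.prod_mul_distrib, ← integral_fintype_prod_volume_eq_prod, hX, hY, map_prod, ← Finset.prod_mul_distrib]
  congr 2
  ext θ
  rw [Finset.prod_mul_distrib, ← Complex.exp_sum, ← Finset.sum_mul]
  push_cast
  rw [Finset.sum_sub_distrib]

end

end Dephasing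

/-! Upper bound. Photon-number differences are integers, so a matrix element of the output depends
on the law of the angles only through its characteristic function at integers. There the normal law
on the line and the wrapped law on `[-π, π]` agree: both give `gaussCoeff`. Hence the output on `ψ`
is a mixture of the rotated states `rotations θ ψ` over the torus (`dephasingPow_rankOne`). The
weighted difference of two outputs is the same mixture with weight `signedDensity`, and the triangle
inequality for the trace norm (`traceNorm_integral_rankOne_le`) bounds it by the `L¹` norm of that
weight.

Lower bound. Truncated plane waves, averaged over the torus with the factor `(2π)⁻ⁿ`, resolve the
identity on finitely many Fock states. Since `|⟨x, A x⟩| ≤ ⟨x, |A| x⟩`, measuring in them cannot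
exceed the trace norm (`le_traceNorm_truncatedWave`). For the uniform superposition of Fock states
below `N`, the measured density is, up to that factor, the difference of products of Fejér sums of
the two Fourier series (`inner_truncatedWave_uniformState`). By Poisson summation and Cesàro
convergence these tend to `2π p_γ` in each mode, and dominated convergence recovers the whole `L¹`
norm as `N → ∞` (`tendsto_integral_norm_fejerSum`). -/

namespace Dephasing

open Filter Topology

/-! ### Fourier analysis of the normal and wrapped normal densities -/

/-- The Fourier coefficient `e^{-γ m² / 2}` of the wrapped normal distribution. -/
noncomputable def gaussCoeff (γ : ℝ) (m : ℤ) : ℝ := Real.exp (-(γ * (m : ℝ) ^ 2) / 2)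

lemma gaussCoeff_neg (γ : ℝ) (m : ℤ) : gaussCoeff γ (-m) = gaussCoeff γ m := by
  simp [gaussCoeff]

lemma gaussCoeff_nonneg (γ : ℝ) (m : ℤ) : 0 ≤ gaussCoeff γ m := (Real.exp_pos _).le

/-- The coefficients are the norms of the terms of the Jacobi theta series at `z = 0`, `τ =
iγ/(2π)`. -/
lemma summable_gaussCoeff {γ : ℝ} (hγ : 0 < γ) : Summable (gaussCoeff γ) := by
  have h : Summable fun n : ℤ => jacobiTheta₂_term n 0 (((γ / (2 * Real.pi) : ℝ) : ℂ) * Complex.I) := by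
    rw [summable_jacobiTheta₂_term_iff]
    simp only [Complex.im_ofReal_mul, Complex.I_im, mul_one]
    positivity
  refine h.norm.congr fun n => ?_
  rw [norm_jacobiTheta₂_term, gaussCoeff]
  congr 1
  simp only [Complex.im_ofReal_mul, Complex.I_im, Complex.zero_im]
  field_simp
  ring

lemma integral_normalDensity_mul_exp {γ : ℝ} (hγ : 0 < γ) (m : ℤ) :
    ∫ θ : ℝ, (normalDensity γ θ : ℂ) * Complex.exp (((θ * m : ℝ) : ℂ) * Complex.I) =
      gaussCoeff γ m := by
  have hb : 0 < ((1 / (2 * γ) : ℝ) : ℂ).re := by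
    rw [Complex.ofReal_re]; positivity
  have h := fourierIntegral_gaussian hb (m : ℂ)
  have h2 : ((Real.pi : ℂ) / ((1 / (2 * γ) : ℝ) : ℂ)) ^ (1 / 2 : ℂ) =
      ((√(2 * Real.pi * γ) : ℝ) : ℂ) := by
    rw [Real.sqrt_eq_rpow, Complex.ofReal_cpow (by positivity)]
    congr 1
    · push_cast; field_simp
    · push_cast; rfl
  have h3 : (√(2 * Real.pi * γ) : ℂ) ≠ 0 := by
    rw [Complex.ofReal_ne_zero]; positivity
  have h4 : ∀ θ : ℝ, (normalDensity γ θ : ℂ) * Complex.exp (((θ * m : ℝ) : ℂ) * Complex.I) =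
      (1 / √(2 * Real.pi * γ) : ℂ) * (Complex.exp (Complex.I * m * θ) *
        Complex.exp (-((1 / (2 * γ) : ℝ) : ℂ) * (θ : ℂ) ^ 2)) := by
    intro θ
    rw [normalDensity]
    push_cast
    rw [mul_assoc, ← Complex.exp_add, ← Complex.exp_add]
    congr 2
    field_simp
    ring
  simp_rw [h4]
  rw [integral_const_mul, h, h2, ← mul_assoc, one_div_mul_cancel h3, one_mul, gaussCoeff,
    Complex.ofReal_exp]
  congr 1
  push_cast
  have : (γ : ℂ) ≠ 0 := by exact_mod_cast hγ.ne'
  field_simp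
  ring

lemma norm_gaussCoeff_mul_exp (γ x : ℝ) (m : ℤ) :
    ‖(gaussCoeff γ m : ℂ) * Complex.exp (((x * m : ℝ) : ℂ) * Complex.I)‖ = gaussCoeff γ m := by
  rw [norm_mul, Complex.norm_exp_ofReal_mul_I, mul_one, Complex.norm_real, Real.norm_eq_abs,
    abs_of_nonneg (gaussCoeff_nonneg _ _)]

lemma summable_gaussCoeff_mul_exp {γ : ℝ} (hγ : 0 < γ) (x : ℝ) :
    Summable fun m : ℤ => (gaussCoeff γ m : ℂ) * Complex.exp (((x * m : ℝ) : ℂ) * Complex.I) :=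
  Summable.of_norm <| (summable_gaussCoeff hγ).congr fun m => (norm_gaussCoeff_mul_exp γ x m).symm

/-- The Fourier series of the wrapped normal density, by Poisson summation. -/
lemma tsum_gaussCoeff_mul_exp {γ : ℝ} (hγ : 0 < γ) (x : ℝ) :
    ∑' m : ℤ, (gaussCoeff γ m : ℂ) * Complex.exp (((x * m : ℝ) : ℂ) * Complex.I) =
      2 * Real.pi * (wrappedNormal γ x : ℂ) := by
  have hγ' : (γ : ℂ) ≠ 0 := by exact_mod_cast hγ.ne'
  have hπ : (Real.pi : ℂ) ≠ 0 := by exact_mod_cast Real.pi_ne_zero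
  have ha : 0 < ((γ / (2 * Real.pi) : ℝ) : ℂ).re := by
    rw [Complex.ofReal_re]; positivity
  -- With `a = γ/(2π)` and `b = ix/(2π)`, the summand `exp(-πam² + 2πbm)` is the Fourier term.
  have h := Complex.tsum_exp_neg_quadratic ha (x / (2 * Real.pi) * Complex.I)
  have h1 : ∀ m : ℤ, (gaussCoeff γ m : ℂ) * Complex.exp (((x * m : ℝ) : ℂ) * Complex.I) =
      Complex.exp (-Real.pi * ((γ / (2 * Real.pi) : ℝ) : ℂ) * m ^ 2 +
        2 * Real.pi * (x / (2 * Real.pi) * Complex.I) * m) := by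
    intro m
    rw [gaussCoeff, Complex.ofReal_exp, ← Complex.exp_add]
    congr 1
    push_cast
    field_simp
  -- Poisson summation produces `(m - x/(2π))²`, which is the wrapped term of index `-m`; `h6`
  -- undoes this sign.
  have h2 : ∀ m : ℤ, Complex.exp (-Real.pi / ((γ / (2 * Real.pi) : ℝ) : ℂ) *
      (m + Complex.I * (x / (2 * Real.pi) * Complex.I)) ^ 2) =
      ((Real.exp (-(x + 2 * Real.pi * (-m : ℤ)) ^ 2 / (2 * γ)) : ℝ) : ℂ) := by
    intro m
    rw [Complex.ofReal_exp]
    congr 1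
    have : Complex.I * (x / (2 * Real.pi) * Complex.I) = - (x / (2 * Real.pi)) := by
      linear_combination (x / (2 * Real.pi) : ℂ) * Complex.I_mul_I
    rw [this]
    push_cast
    field_simp
    ring
  have h3 : (((γ / (2 * Real.pi) : ℝ) : ℂ)) ^ (1 / 2 : ℂ) =
      ((√(γ / (2 * Real.pi)) : ℝ) : ℂ) := by
    rw [Real.sqrt_eq_rpow, Complex.ofReal_cpow (by positivity)]
    norm_num
  have h4 : (1 : ℝ) / √(γ / (2 * Real.pi)) = 2 * Real.pi * (1 / √(2 * Real.pi * γ)) := by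
    have : √(2 * Real.pi * γ) = 2 * Real.pi * √(γ / (2 * Real.pi)) := by
      rw [← Real.sqrt_sq (by positivity : 0 ≤ 2 * Real.pi), ← Real.sqrt_mul (by positivity),
        Real.sqrt_sq (by positivity)]
      congr 1
      field_simp
    rw [this]
    field_simp
  have h6 := (Equiv.neg ℤ).tsum_eq (fun m : ℤ =>
    ((Real.exp (-(x + 2 * Real.pi * (m : ℤ)) ^ 2 / (2 * γ)) : ℝ) : ℂ))
  simp only [Equiv.neg_apply] at h6
  simp_rw [h1, h, h2, h3]
  rw [wrappedNormal, h6, ← Complex.ofReal_tsum]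
  have h5 := congrArg (Complex.ofReal) h4
  push_cast at h5 ⊢
  rw [h5]
  ring

/-- The Fourier series converges uniformly in `x`, unlike the defining Gaussian sum, whose terms
have no summable bound valid on the whole line. -/
lemma continuous_wrappedNormal {γ : ℝ} (hγ : 0 < γ) : Continuous (wrappedNormal γ) := by
  have h : Continuous fun x : ℝ => ∑' m : ℤ,
      (gaussCoeff γ m : ℂ) * Complex.exp (((x * m : ℝ) : ℂ) * Complex.I) :=
    continuous_tsum (fun m => by fun_prop) (summable_gaussCoeff hγ)
      fun m x => (norm_gaussCoeff_mul_exp γ x m).le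
  simp_rw [tsum_gaussCoeff_mul_exp hγ] at h
  have h2 : Continuous fun x : ℝ => (2 * Real.pi)⁻¹ * (2 * Real.pi * (wrappedNormal γ x : ℂ)).re :=
    continuous_const.mul (Complex.continuous_re.comp h)
  convert h2 using 2 with x
  have : (2 * Real.pi * (wrappedNormal γ x : ℂ)) = ((2 * Real.pi * wrappedNormal γ x : ℝ) : ℂ) := by
    push_cast; rfl
  rw [this, Complex.ofReal_re]
  field_simp

lemma integral_exp_int_mul (m : ℤ) :
    ∫ x in Set.Icc (-Real.pi) Real.pi, Complex.exp (((x * m : ℝ) : ℂ) * Complex.I) =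
      if m = 0 then 2 * (Real.pi : ℂ) else 0 := by
  rw [integral_Icc_eq_integral_Ioc, ← intervalIntegral.integral_of_le (by linarith [Real.pi_pos])]
  split_ifs with h
  · subst h
    simp
    ring
  · have hc : (m : ℂ) * Complex.I ≠ 0 := by simp [h]
    have := integral_exp_mul_complex (a := -Real.pi) (b := Real.pi) hc
    rw [show (fun x : ℝ => Complex.exp (((x * m : ℝ) : ℂ) * Complex.I)) =
      fun x : ℝ => Complex.exp (m * Complex.I * x) by ext x; push_cast; ring_nf, this, div_eq_zero_iff]
    left
    rw [sub_eq_zero, Complex.exp_eq_exp_iff_exists_int]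
    exact ⟨m, by push_cast; ring⟩

/-- Integrating the Fourier series term by term leaves only the index `-m`. The value agrees with
`integral_normalDensity_mul_exp`, which is why wrapping the angle is invisible at integer
frequencies. -/
lemma integral_wrappedNormal_mul_exp {γ : ℝ} (hγ : 0 < γ) (m : ℤ) :
    ∫ θ in Set.Icc (-Real.pi) Real.pi,
      (wrappedNormal γ θ : ℂ) * Complex.exp (((θ * m : ℝ) : ℂ) * Complex.I) = gaussCoeff γ m := by
  have hπ : (2 * Real.pi : ℂ) ≠ 0 := by exact_mod_cast Real.two_pi_pos.ne'
  have h : ∀ θ : ℝ, (wrappedNormal γ θ : ℂ) * Complex.exp (((θ * m : ℝ) : ℂ) * Complex.I) =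
      (2 * Real.pi : ℂ)⁻¹ * ∑' k : ℤ, (gaussCoeff γ k : ℂ) *
        Complex.exp (((θ * (k + m : ℤ) : ℝ) : ℂ) * Complex.I) := by
    intro θ
    have : ∀ k : ℤ, (gaussCoeff γ k : ℂ) *
        Complex.exp (((θ * (k + m : ℤ) : ℝ) : ℂ) * Complex.I) = (gaussCoeff γ k : ℂ) *
        Complex.exp (((θ * k : ℝ) : ℂ) * Complex.I) *
          Complex.exp (((θ * m : ℝ) : ℂ) * Complex.I) := by
      intro k
      rw [mul_assoc, ← Complex.exp_add]
      push_cast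
      ring_nf
    simp_rw [this, tsum_mul_right, tsum_gaussCoeff_mul_exp hγ]
    field_simp
  simp_rw [h]
  rw [integral_const_mul, ← integral_tsum_of_summable_integral_norm]
  · simp_rw [integral_const_mul, integral_exp_int_mul]
    rw [tsum_eq_single (-m)]
    · rw [gaussCoeff_neg]
      simp only [neg_add_cancel, if_true]
      field_simp
    · intro k hk
      rw [if_neg (by omega), mul_zero]
  · intro k
    exact (Continuous.integrableOn_Icc (by fun_prop))
  · have : ∀ (k : ℤ) (θ : ℝ), ‖(gaussCoeff γ k : ℂ) *
        Complex.exp (((θ * (k + m : ℤ) : ℝ) : ℂ) * Complex.I)‖ = gaussCoeff γ k := by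
      intro k θ
      rw [norm_mul, Complex.norm_exp_ofReal_mul_I, mul_one, Complex.norm_real, Real.norm_eq_abs,
        abs_of_nonneg (gaussCoeff_nonneg _ _)]
    simp_rw [this]
    simp only [integral_const]
    exact (summable_gaussCoeff hγ).mul_left _

/-! ### Fejér sums as Cesàro means -/

/-- The normalized sum of the Toeplitz matrix `c (a - b)` over `a, b < N`; for
`c m = f̂(m) e^{imx}` it is the Fejér mean of `f` at `x`. -/
noncomputable def fejerSum (c : ℤ → ℂ) (N : ℕ) : ℂ :=
  (N : ℂ)⁻¹ * ∑ a ∈ Finset.range N, ∑ b ∈ Finset.range N, c ((a : ℤ) - b)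

/-- For fixed `a` the map `b ↦ a - b` is injective, so each of the `N` rows contributes at most `∑
g`. The bound is uniform in `N`, as dominated convergence requires. -/
lemma norm_fejerSum_le {c : ℤ → ℂ} {g : ℤ → ℝ} (hg : Summable g) (h : ∀ m, ‖c m‖ ≤ g m) (N : ℕ) :
    ‖fejerSum c N‖ ≤ ∑' m, g m := by
  have hg0 : ∀ m, 0 ≤ g m := fun m => (norm_nonneg _).trans (h m)
  rcases Nat.eq_zero_or_pos N with rfl | hN
  · simp [fejerSum, tsum_nonneg hg0]
  · have h1 : ‖∑ a ∈ Finset.range N, ∑ b ∈ Finset.range N, c ((a : ℤ) - b)‖ ≤ N * ∑' m, g m := by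
      refine (norm_sum_le _ _).trans ?_
      have : ∀ a ∈ Finset.range N, ‖∑ b ∈ Finset.range N, c ((a : ℤ) - b)‖ ≤ ∑' m, g m := by
        intro a _
        refine (norm_sum_le _ _).trans ((Finset.sum_le_sum fun b _ => h _).trans ?_)
        have hinj : Function.Injective fun b : ℕ => (a : ℤ) - b := by
          intro b b' hb
          simp only at hb
          omega
        have hs := hg.comp_injective hinj
        refine (hs.sum_le_tsum (Finset.range N) fun b _ => hg0 _).trans ?_
        exact hs.tsum_le_tsum_of_inj _ hinj (fun _ _ => hg0 _) (fun _ => le_rfl) hg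
      refine (Finset.sum_le_sum this).trans ?_
      simp
    rw [fejerSum, norm_mul, norm_inv, Complex.norm_natCast]
    have hN' : (0 : ℝ) < N := by exact_mod_cast hN
    rw [inv_mul_le_iff₀ hN']
    exact h1

/-- Enlarging the square from `N` to `N + 1` adds one row, one column and the corner, whose
differences run once through `-N, …, N`. -/
lemma sum_sub_eq_sum_symm_partial (c : ℤ → ℂ) (N : ℕ) :
    ∑ a ∈ Finset.range N, ∑ b ∈ Finset.range N, c ((a : ℤ) - b) =
      ∑ K ∈ Finset.range N, ∑ m ∈ Finset.Icc (-(K : ℤ)) K, c m := by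
  induction N with
  | zero => simp
  | succ N ih =>
    rw [Finset.sum_range_succ (fun K : ℕ => ∑ m ∈ Finset.Icc (-(K : ℤ)) K, c m), ← ih,
      Finset.sum_range_succ (fun a : ℕ => ∑ b ∈ _, _)]
    simp_rw [Finset.sum_range_succ _ N, Finset.sum_add_distrib]
    have : ∀ K : ℕ, ∑ m ∈ Finset.Icc (-(K : ℤ)) K, c m =
        ∑ a ∈ Finset.range K, c (a - K) + (∑ b ∈ Finset.range K, c (K - b) + c (K - K)) := by
      intro K
      induction K with
      | zero => simp
      | succ K ihK =>
        have e : Finset.Icc (-((K + 1 : ℕ) : ℤ)) (K + 1 : ℕ) =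
            insert (-((K + 1 : ℕ) : ℤ)) (insert ((K + 1 : ℕ) : ℤ) (Finset.Icc (-(K : ℤ)) K)) := by
          ext m
          simp only [Finset.mem_Icc, Finset.mem_insert]
          omega
        rw [e, Finset.sum_insert, Finset.sum_insert, ihK, Finset.sum_range_succ',
          Finset.sum_range_succ']
        · push_cast
          simp only [add_sub_add_right_eq_sub, sub_self, zero_sub, sub_zero]
          ring
        · simp
        · simp only [Finset.mem_insert, Finset.mem_Icc]
          omega
    rw [this]
    ring

lemma tendsto_fejerSum {c : ℤ → ℂ} (hc : Summable c) :
    Tendsto (fejerSum c) atTop (𝓝 (∑' m, c m)) := by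
  have h1 : Tendsto (fun K : ℕ => ∑ m ∈ Finset.Icc (-(K : ℤ)) K, c m) atTop (𝓝 (∑' m, c m)) := by
    refine hc.hasSum.comp (tendsto_atTop_finset_of_monotone ?_ ?_)
    · intro K K' h m hm
      simp only [Finset.mem_Icc] at hm ⊢
      omega
    · intro m
      refine ⟨m.natAbs, ?_⟩
      simp only [Finset.mem_Icc]
      omega
  refine h1.cesaro_smul.congr fun N => ?_
  rw [fejerSum, sum_sub_eq_sum_symm_partial]
  simp

/-! ### Trace norm bounds from above -/

variable {ι : Type}

lemma traceNorm_eq_tsum_abs (A : Space ι →L[ℂ] Space ι) :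
    traceNorm A = ∑' i : ι, ENNReal.ofReal (inner ℂ (ket ι i) (CFC.abs A (ket ι i))).re := rfl

lemma re_inner_abs_nonneg (A : Space ι →L[ℂ] Space ι) (x : Space ι) :
    0 ≤ (inner ℂ x (CFC.abs A x)).re :=
  ((ContinuousLinearMap.nonneg_iff_isPositive _).1 (CFC.abs_nonneg A)).re_inner_nonneg_right x

/-- The modulus of a self-adjoint operator dominates the operator and its negative. -/
lemma norm_inner_le_re_inner_abs {A : Space ι →L[ℂ] Space ι} (hA : IsSelfAdjoint A) (x : Space ι) :
    ‖inner ℂ x (A x)‖ ≤ (inner ℂ x (CFC.abs A x)).re := by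
  have hr : inner ℂ x (A x) = (((inner ℂ x (A x)).re : ℝ) : ℂ) := by
    refine (Complex.conj_eq_iff_re.1 ?_).symm
    rw [inner_conj_symm]
    exact (ContinuousLinearMap.isSelfAdjoint_iff_isSymmetric.1 hA) x x
  have h1 : 0 ≤ CFC.abs A - A := by
    rw [CFC.abs_sub_self A hA]
    exact nsmul_nonneg (CFC.negPart_nonneg A) 2
  have h2 : 0 ≤ CFC.abs A + A := by
    rw [CFC.abs_add_self A hA]
    exact nsmul_nonneg (CFC.posPart_nonneg A) 2
  have h1' := ((ContinuousLinearMap.nonneg_iff_isPositive _).1 h1).re_inner_nonneg_right x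
  have h2' := ((ContinuousLinearMap.nonneg_iff_isPositive _).1 h2).re_inner_nonneg_right x
  simp only [_root_.sub_apply, _root_.add_apply, inner_sub_right, inner_add_right,
    RCLike.re_to_complex, Complex.sub_re, Complex.add_re] at h1' h2'
  rw [hr, Complex.norm_real, Real.norm_eq_abs, abs_le]
  constructor <;> linarith

/-- The modulus of a self-adjoint operator is a norm limit of products `S A` with
contractions `S`. -/
lemma exists_contraction_mul_near_abs {A : Space ι →L[ℂ] Space ι} (hA : IsSelfAdjoint A) {ε : ℝ}
    (hε : 0 < ε) : ∃ S : Space ι →L[ℂ] Space ι, ‖S‖ ≤ 1 ∧ ‖CFC.abs A - S * A‖ ≤ ε := by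
  -- The function `x / (|x| + ε)` is a continuous replacement for the sign, so the continuous
  -- functional calculus applies; the error `|x| - x²/(|x| + ε)` is `ε|x|/(|x| + ε) ≤ ε`.
  have hpos : ∀ x : ℝ, 0 < |x| + ε := fun x => by positivity
  have hc : Continuous fun x : ℝ => x / (|x| + ε) :=
    continuous_id.div (by fun_prop) fun x => (hpos x).ne'
  refine ⟨cfc (fun x : ℝ => x / (|x| + ε)) A, norm_cfc_le zero_le_one fun x _ => ?_, ?_⟩
  · rw [Real.norm_eq_abs, abs_div, abs_of_pos (hpos x), div_le_one (hpos x)]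
    linarith
  · have h1 : cfc (fun x : ℝ => x / (|x| + ε)) A * A = cfc (fun x : ℝ => x / (|x| + ε) * x) A := by
      rw [cfc_mul (fun x : ℝ => x / (|x| + ε)) (fun x => x) A hc.continuousOn (continuousOn_id' _),
        cfc_id' ℝ A]
    have hc2 : Continuous fun x : ℝ => x / (|x| + ε) * x := hc.mul continuous_id
    rw [h1, CFC.abs_eq_cfc_norm A hA, ← cfc_sub (fun x : ℝ => ‖x‖) _ A
      continuous_norm.continuousOn hc2.continuousOn]
    refine norm_cfc_le hε.le fun x _ => ?_
    have : ‖x‖ - x / (|x| + ε) * x = ε * (|x| / (|x| + ε)) := by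
      have := (hpos x).ne'
      rw [Real.norm_eq_abs]
      field_simp
      rw [← sq_abs x]
      ring
    rw [this, norm_mul, Real.norm_eq_abs ε, abs_of_pos hε, Real.norm_eq_abs, abs_div, abs_abs,
      abs_of_pos (hpos x)]
    refine mul_le_of_le_one_right hε.le ?_
    rw [div_le_one (hpos x)]
    linarith

lemma norm_ket (i : ι) : ‖ket ι i‖ = 1 := (ket ι).orthonormal.norm_eq_one i

/-- On finitely many basis vectors `|A|` may be replaced by `S A` at arbitrarily small cost, which
makes the partial traces linear in `A`. -/
lemma traceNorm_le_of_contraction {A : Space ι →L[ℂ] Space ι} (hA : IsSelfAdjoint A) {C : ℝ}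
    (h : ∀ S : Space ι →L[ℂ] Space ι, ‖S‖ ≤ 1 → ∀ F : Finset ι,
      (∑ i ∈ F, inner ℂ (ket ι i) (S (A (ket ι i)))).re ≤ C) :
    traceNorm A ≤ ENNReal.ofReal C := by
  rw [traceNorm_eq_tsum_abs, ENNReal.tsum_eq_iSup_sum]
  refine iSup_le fun F => ?_
  rw [← ENNReal.ofReal_sum_of_nonneg fun i _ => re_inner_abs_nonneg A _]
  refine ENNReal.ofReal_le_ofReal (le_of_forall_pos_le_add fun ε hε => ?_)
  -- The error `ε` is shared among the elements of `F`; the `+ 1` covers empty `F`.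
  have hF : (0 : ℝ) < F.card + 1 := by positivity
  obtain ⟨S, hS, hSA⟩ := exists_contraction_mul_near_abs hA (div_pos hε hF)
  have h1 : ∀ i ∈ F, (inner ℂ (ket ι i) (CFC.abs A (ket ι i))).re ≤
      (inner ℂ (ket ι i) (S (A (ket ι i)))).re + ε / (F.card + 1) := by
    intro i _
    have h2 : ‖inner ℂ (ket ι i) ((CFC.abs A - S * A) (ket ι i))‖ ≤ ε / (F.card + 1) := by
      refine (norm_inner_le_norm _ _).trans ?_
      rw [norm_ket, one_mul]
      refine ((CFC.abs A - S * A).le_opNorm _).trans ?_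
      rwa [norm_ket, mul_one]
    have h3 := (Complex.re_le_norm _).trans h2
    simp only [_root_.sub_apply, inner_sub_right, Complex.sub_re,
      mul_apply_eq_comp] at h3
    linarith
  refine (Finset.sum_le_sum h1).trans ?_
  rw [Finset.sum_add_distrib, ← Complex.re_sum, Finset.sum_const, nsmul_eq_mul]
  refine add_le_add (h S hS F) ?_
  rw [mul_div_assoc', div_le_iff₀ hF]
  nlinarith

lemma isSelfAdjoint_integral_rankOne {X : Type*} [MeasurableSpace X] {μ : Measure X} {w : X → ℝ}
    {u : X → Space ι}
    (hI : Integrable (fun t => (w t : ℂ) • InnerProductSpace.rankOne ℂ (u t) (u t)) μ) :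
    IsSelfAdjoint (∫ t, (w t : ℂ) • InnerProductSpace.rankOne ℂ (u t) (u t) ∂μ) := by
  rw [ContinuousLinearMap.isSelfAdjoint_iff_isSymmetric]
  intro x y
  simp only [ContinuousLinearMap.coe_coe, ContinuousLinearMap.integral_apply hI]
  rw [← inner_conj_symm, ← integral_inner (hI.apply_continuousLinearMap _),
    ← integral_inner (hI.apply_continuousLinearMap _), ← integral_conj]
  congr 1
  ext t
  simp only [_root_.smul_apply, InnerProductSpace.rankOne_apply, inner_smul_right, map_mul,
    inner_conj_symm, Complex.conj_ofReal]
  ring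

/-- The triangle inequality for the trace norm of a mixture of pure states with signed weights. -/
lemma traceNorm_integral_rankOne_le {X : Type*} [MeasurableSpace X] {μ : Measure X} {w : X → ℝ}
    (hw : Integrable w μ) {u : X → Space ι} (hu : ∀ t, ‖u t‖ = 1)
    (hI : Integrable (fun t => (w t : ℂ) • InnerProductSpace.rankOne ℂ (u t) (u t)) μ) :
    traceNorm (∫ t, (w t : ℂ) • InnerProductSpace.rankOne ℂ (u t) (u t) ∂μ) ≤
      ENNReal.ofReal (∫ t, |w t| ∂μ) := by
  refine traceNorm_le_of_contraction (isSelfAdjoint_integral_rankOne hI) fun S hS F => ?_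
  have h1 : ∀ i, inner ℂ (ket ι i)
      (S ((∫ t, (w t : ℂ) • InnerProductSpace.rankOne ℂ (u t) (u t) ∂μ) (ket ι i))) =
      ∫ t, (w t : ℂ) * (inner ℂ (ket ι i) (S (u t)) * inner ℂ (u t) (ket ι i)) ∂μ := by
    intro i
    rw [ContinuousLinearMap.integral_apply hI,
      ← S.integral_comp_comm (hI.apply_continuousLinearMap _),
      ← integral_inner (S.integrable_comp (hI.apply_continuousLinearMap _))]
    congr 1
    ext t
    simp only [_root_.smul_apply, InnerProductSpace.rankOne_apply, inner_smul_right, map_smul]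
    ring
  have h2 : ∀ i, Integrable (fun t => (w t : ℂ) *
      (inner ℂ (ket ι i) (S (u t)) * inner ℂ (u t) (ket ι i))) μ := by
    intro i
    refine ((S.integrable_comp (hI.apply_continuousLinearMap (ket ι i))).const_inner
      (𝕜 := ℂ) (ket ι i)).congr (Eventually.of_forall fun t => ?_)
    simp only [_root_.smul_apply, InnerProductSpace.rankOne_apply, inner_smul_right, map_smul]
    ring
  simp_rw [h1]
  rw [← integral_finsetSum _ fun i _ => h2 i]
  refine (Complex.re_le_norm _).trans ((norm_integral_le_integral_norm _).trans ?_)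
  refine integral_mono (integrable_finsetSum _ fun i _ => h2 i).norm hw.norm fun t => ?_
  simp only
  rw [← Finset.mul_sum, norm_mul, Complex.norm_real, Real.norm_eq_abs]
  refine mul_le_of_le_one_right (abs_nonneg _) ?_
  have hsu : ‖S (u t)‖ ≤ 1 := by
    refine (S.le_opNorm _).trans ?_
    rwa [hu, mul_one]
  -- Bessel's inequality for `S (u t)` and `u t`, combined by Cauchy–Schwarz, bounds the partial
  -- trace of `S |u⟩⟨u|` by `1`, independently of `F`.
  have h3 := (ket ι).orthonormal.sum_inner_products_le (s := F) (S (u t))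
  have h4 := (ket ι).orthonormal.sum_inner_products_le (s := F) (u t)
  rw [hu] at h4
  have h5 := Real.sum_mul_le_sqrt_mul_sqrt F (fun i => ‖inner ℂ (ket ι i) (S (u t))‖)
    (fun i => ‖inner ℂ (ket ι i) (u t)‖)
  refine (norm_sum_le _ _).trans ?_
  simp_rw [norm_mul, norm_inner_symm (u t)]
  refine h5.trans (mul_le_one₀ ?_ (Real.sqrt_nonneg _) ?_)
  · rw [Real.sqrt_le_one]
    nlinarith [norm_nonneg (S (u t))]
  · rw [Real.sqrt_le_one]
    simpa using h4

/-! ### Dephasing as a mixture of rotations over the torus -/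

lemma ext_ket {ι : Type} {A B : Space ι →L[ℂ] Space ι}
    (h : ∀ i j, inner ℂ (ket ι i) (A (ket ι j)) = inner ℂ (ket ι i) (B (ket ι j))) : A = B := by
  refine ContinuousLinearMap.ext_on (s := Set.range (ket ι)) ?_ ?_
  · have := (ket ι).dense_span
    rw [← Submodule.dense_iff_topologicalClosure_eq_top] at this
    exact this
  · rintro _ ⟨j, rfl⟩
    apply (ket ι).repr.injective
    ext i
    rw [HilbertBasis.repr_apply_apply, HilbertBasis.repr_apply_apply, h]

lemma phaseOp_comp_rankOne_comp_adjoint {ι : Type} (φ : ι → ℝ) (x y : Space ι) :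
    phaseOp φ ∘L InnerProductSpace.rankOne ℂ x y ∘L ContinuousLinearMap.adjoint (phaseOp φ) =
      InnerProductSpace.rankOne ℂ (phaseOp φ x) (phaseOp φ y) := by
  rw [InnerProductSpace.rankOne_comp, InnerProductSpace.comp_rankOne]
  simp

/-- The cube `[-π, π]ⁿ`. -/
def torusBox (n : ℕ) : Set (Fin n → ℝ) :=
  Set.Icc (fun _ : Fin n => -Real.pi) (fun _ : Fin n => Real.pi)

lemma volume_restrict_torusBox (n : ℕ) :
    (volume : Measure (Fin n → ℝ)).restrict (torusBox n) =
      Measure.pi fun _ : Fin n => (volume : Measure ℝ).restrict (Set.Icc (-Real.pi) Real.pi) := by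
  rw [torusBox, ← Set.pi_univ_Icc, volume_pi, Measure.restrict_pi_pi]

/-- Independent angles make the characteristic function factor over the modes. A general measure `μ`
lets this serve both the line and `[-π, π]`. -/
lemma integral_prod_mul_exp_sum {n : ℕ} (μ : Measure ℝ) [SigmaFinite μ] (p : ℝ → ℝ)
    (i j : Fin n → ℕ) :
    ∫ θ : Fin n → ℝ, ((∏ k, p (θ k) : ℝ) : ℂ) *
      Complex.exp (((∑ k, θ k * j k - ∑ k, θ k * i k : ℝ) : ℂ) * Complex.I)
        ∂(Measure.pi fun _ => μ) =
      ∏ k, ∫ x, (p x : ℂ) * Complex.exp (((x * ((j k : ℤ) - i k : ℤ) : ℝ) : ℂ) * Complex.I) ∂μ := by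
  rw [← integral_fintype_prod_eq_prod (𝕜 := ℂ) (μ := fun _ : Fin n => μ)
    (fun k x => (p x : ℂ) * Complex.exp (((x * ((j k : ℤ) - i k : ℤ) : ℝ) : ℂ) * Complex.I))]
  congr 1
  ext θ
  rw [Finset.prod_mul_distrib, ← Complex.exp_sum, ← Finset.sum_mul, ← Finset.sum_sub_distrib]
  push_cast
  simp_rw [mul_sub]

lemma continuous_rotations {n : ℕ} (ψ : Modes n) :
    Continuous fun θ : Fin n → ℝ => rotations θ ψ :=
  continuous_phaseOp (fun (θ : Fin n → ℝ) (m : Fin n → ℕ) => ∑ k, θ k * m k)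
    (fun i => by fun_prop) ψ

lemma integrable_torusBox_rankOne {n : ℕ} {w : (Fin n → ℝ) → ℝ} (hw : Continuous w)
    (ψ : Modes n) :
    Integrable (fun θ => (w θ : ℂ) •
      InnerProductSpace.rankOne ℂ (rotations θ ψ) (rotations θ ψ))
      (volume.restrict (torusBox n)) :=
  ((Complex.continuous_ofReal.comp hw).smul (continuous_rankOne _ _ (continuous_rotations ψ)
    (continuous_rotations ψ))).integrableOn_Icc

lemma continuous_prod_wrappedNormal (n : ℕ) {γ : ℝ} (hγ : 0 < γ) :
    Continuous fun θ : Fin n → ℝ => ∏ k, wrappedNormal γ (θ k) :=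
  continuous_finsetProd _ fun k _ => (continuous_wrappedNormal hγ).comp (continuous_apply k)

lemma inner_dephasingPow_rankOne (n : ℕ) {γ : ℝ} (hγ : 0 < γ) (ψ : Modes n) (i j : Fin n → ℕ) :
    inner ℂ (ket _ i) (dephasingPow n γ (InnerProductSpace.rankOne ℂ ψ ψ) (ket _ j)) =
      (∏ k, (gaussCoeff γ ((j k : ℤ) - i k) : ℂ)) *
        ((ket _).repr ψ i * starRingEnd ℂ ((ket _).repr ψ j)) := by
  unfold dephasingPow rotations
  rw [mix_entry volume (fun (θ : Fin n → ℝ) (m : Fin n → ℕ) => ∑ k, θ k * m k)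
    (by intro i; fun_prop) (fun θ => ∏ k, normalDensity γ (θ k))
    (Integrable.fintype_prod (fun _ => integrable_normalDensity hγ)), volume_pi,
    integral_prod_mul_exp_sum]
  simp_rw [integral_normalDensity_mul_exp hγ]

/-- On pure states the dephasing channel is a mixture of rotations by wrapped angles. -/
lemma dephasingPow_rankOne (n : ℕ) {γ : ℝ} (hγ : 0 < γ) (ψ : Modes n) :
    dephasingPow n γ (InnerProductSpace.rankOne ℂ ψ ψ) =
      ∫ θ in torusBox n, ((∏ k, wrappedNormal γ (θ k) : ℝ) : ℂ) •
        InnerProductSpace.rankOne ℂ (rotations θ ψ) (rotations θ ψ) := by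
  refine ext_ket fun i j => ?_
  have h := mix_entry (volume.restrict (torusBox n))
    (fun (θ : Fin n → ℝ) (m : Fin n → ℕ) => ∑ k, θ k * m k)
    (by intro i; fun_prop) (fun θ => ∏ k, wrappedNormal γ (θ k))
    ((continuous_prod_wrappedNormal n hγ).integrableOn_Icc) ψ ψ i j
  simp_rw [phaseOp_comp_rankOne_comp_adjoint] at h
  refine (inner_dephasingPow_rankOne n hγ ψ i j).trans (Eq.trans ?_ h.symm)
  rw [volume_restrict_torusBox, integral_prod_mul_exp_sum]
  simp_rw [integral_wrappedNormal_mul_exp hγ]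

/-! ### The difference of the two outputs -/

/-- The signed density whose `L¹` norm is the claimed supremum. -/
noncomputable def signedDensity (n : ℕ) (γ₁ γ₂ q₁ q₂ : ℝ) (θ : Fin n → ℝ) : ℝ :=
  q₁ * ∏ k, wrappedNormal γ₁ (θ k) - q₂ * ∏ k, wrappedNormal γ₂ (θ k)

section Difference

variable {n : ℕ} {γ₁ γ₂ : ℝ}

lemma continuous_signedDensity (hγ₁ : 0 < γ₁) (hγ₂ : 0 < γ₂) (q₁ q₂ : ℝ) :
    Continuous (signedDensity n γ₁ γ₂ q₁ q₂) :=
  (continuous_const.mul (continuous_prod_wrappedNormal n hγ₁)).sub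
    (continuous_const.mul (continuous_prod_wrappedNormal n hγ₂))

lemma dephasingPow_sub_rankOne (hγ₁ : 0 < γ₁) (hγ₂ : 0 < γ₂) (q₁ q₂ : ℝ) (ψ : Modes n) :
    (q₁ : ℂ) • dephasingPow n γ₁ (InnerProductSpace.rankOne ℂ ψ ψ) -
        (q₂ : ℂ) • dephasingPow n γ₂ (InnerProductSpace.rankOne ℂ ψ ψ) =
      ∫ θ in torusBox n, (signedDensity n γ₁ γ₂ q₁ q₂ θ : ℂ) •
        InnerProductSpace.rankOne ℂ (rotations θ ψ) (rotations θ ψ) := by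
  rw [dephasingPow_rankOne n hγ₁, dephasingPow_rankOne n hγ₂, ← integral_smul, ← integral_smul,
    ← integral_sub]
  · congr 1
    ext1 θ
    rw [signedDensity, smul_smul, smul_smul, ← sub_smul]
    push_cast
    rfl
  · exact (integrable_torusBox_rankOne (continuous_prod_wrappedNormal n hγ₁) ψ).smul (q₁ : ℂ)
  · exact (integrable_torusBox_rankOne (continuous_prod_wrappedNormal n hγ₂) ψ).smul (q₂ : ℂ)

lemma traceNorm_dephasingPow_sub_le (hγ₁ : 0 < γ₁) (hγ₂ : 0 < γ₂) (q₁ q₂ : ℝ) {ψ : Modes n}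
    (hψ : ‖ψ‖ = 1) :
    traceNorm ((q₁ : ℂ) • dephasingPow n γ₁ (InnerProductSpace.rankOne ℂ ψ ψ) -
        (q₂ : ℂ) • dephasingPow n γ₂ (InnerProductSpace.rankOne ℂ ψ ψ)) ≤
      ENNReal.ofReal (∫ θ in torusBox n, |signedDensity n γ₁ γ₂ q₁ q₂ θ|) := by
  have hc := continuous_signedDensity (n := n) hγ₁ hγ₂ q₁ q₂
  rw [dephasingPow_sub_rankOne hγ₁ hγ₂]
  exact traceNorm_integral_rankOne_le hc.integrableOn_Icc
    (fun θ => (norm_phaseOp _ ψ).trans hψ) (integrable_torusBox_rankOne hc ψ)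

lemma isSelfAdjoint_dephasingPow_sub (hγ₁ : 0 < γ₁) (hγ₂ : 0 < γ₂) (q₁ q₂ : ℝ) (ψ : Modes n) :
    IsSelfAdjoint ((q₁ : ℂ) • dephasingPow n γ₁ (InnerProductSpace.rankOne ℂ ψ ψ) -
        (q₂ : ℂ) • dephasingPow n γ₂ (InnerProductSpace.rankOne ℂ ψ ψ)) := by
  rw [dephasingPow_sub_rankOne hγ₁ hγ₂]
  exact isSelfAdjoint_integral_rankOne
    (integrable_torusBox_rankOne (continuous_signedDensity hγ₁ hγ₂ q₁ q₂) ψ)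

end Difference

/-! ### Plane waves and the lower bound for the trace norm -/

section Torus

variable {n : ℕ}

/-- The plane wave `∑_{m ∈ F} e^{-i θ·m} |m⟩` truncated to a finite set `F` of Fock states. -/
noncomputable def truncatedWave (F : Finset (Fin n → ℕ)) (θ : Fin n → ℝ) : Modes n :=
  ∑ m ∈ F, Complex.exp (-((∑ k, θ k * m k : ℝ) : ℂ) * Complex.I) • ket _ m

lemma continuous_truncatedWave (F : Finset (Fin n → ℕ)) : Continuous (truncatedWave F) := by
  unfold truncatedWave
  fun_prop

lemma inner_truncatedWave (F : Finset (Fin n → ℕ)) (B : Modes n →L[ℂ] Modes n)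
    (θ : Fin n → ℝ) :
    inner ℂ (truncatedWave F θ) (B (truncatedWave F θ)) =
      ∑ i ∈ F, ∑ j ∈ F,
        Complex.exp (((∑ k, θ k * i k - ∑ k, θ k * j k : ℝ) : ℂ) * Complex.I) *
          inner ℂ (ket _ i) (B (ket _ j)) := by
  rw [truncatedWave, sum_inner]
  refine Finset.sum_congr rfl fun i _ => ?_
  rw [map_sum, inner_sum]
  refine Finset.sum_congr rfl fun j _ => ?_
  rw [map_smul, inner_smul_left, inner_smul_right, ← mul_assoc, ← Complex.exp_conj,
    ← Complex.exp_add]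
  congr 2
  rw [map_mul, map_neg, Complex.conj_ofReal, Complex.conj_I]
  push_cast
  ring

lemma integral_torusBox_exp (i j : Fin n → ℕ) :
    ∫ θ in torusBox n,
      Complex.exp (((∑ k, θ k * i k - ∑ k, θ k * j k : ℝ) : ℂ) * Complex.I) =
      if i = j then (2 * (Real.pi : ℂ)) ^ n else 0 := by
  have h := integral_prod_mul_exp_sum
    ((volume : Measure ℝ).restrict (Set.Icc (-Real.pi) Real.pi)) (fun _ => 1) j i
  rw [← volume_restrict_torusBox] at h
  simp only [Finset.prod_const_one, Complex.ofReal_one, one_mul, integral_exp_int_mul] at h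
  rw [h]
  split_ifs with hij
  · subst hij
    simp
  · obtain ⟨k, hk⟩ := Function.ne_iff.1 hij
    exact Finset.prod_eq_zero (Finset.mem_univ k) (if_neg (by omega))

/-- Orthogonality of characters removes the off-diagonal terms: the averaged plane-wave projectors
form `(2π)ⁿ` times the projection onto the span of `F`. -/
lemma integral_inner_truncatedWave (F : Finset (Fin n → ℕ)) (B : Modes n →L[ℂ] Modes n) :
    ∫ θ in torusBox n, inner ℂ (truncatedWave F θ) (B (truncatedWave F θ)) =
      (2 * (Real.pi : ℂ)) ^ n * ∑ i ∈ F, inner ℂ (ket _ i) (B (ket _ i)) := by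
  have hI : ∀ i j : Fin n → ℕ, Integrable (fun θ : Fin n → ℝ =>
      Complex.exp (((∑ k, θ k * i k - ∑ k, θ k * j k : ℝ) : ℂ) * Complex.I) *
        inner ℂ (ket _ i) (B (ket _ j))) (volume.restrict (torusBox n)) := fun i j =>
    Continuous.integrableOn_Icc (by fun_prop)
  simp_rw [inner_truncatedWave]
  rw [integral_finsetSum _ fun i _ => integrable_finsetSum _ fun j _ => hI i j, Finset.mul_sum]
  refine Finset.sum_congr rfl fun i hi => ?_
  rw [integral_finsetSum _ fun j _ => hI i j]
  simp_rw [integral_mul_const, integral_torusBox_exp, ite_mul, zero_mul]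
  rw [Finset.sum_ite_eq, if_pos hi]

/-- The trace norm is bounded below by the measurement in truncated plane waves. -/
lemma le_traceNorm_truncatedWave {A : Modes n →L[ℂ] Modes n} (hA : IsSelfAdjoint A)
    (F : Finset (Fin n → ℕ)) :
    ENNReal.ofReal (((2 * Real.pi) ^ n)⁻¹ *
      ∫ θ in torusBox n, ‖inner ℂ (truncatedWave F θ) (A (truncatedWave F θ))‖) ≤ traceNorm A := by
  have hΩ := continuous_truncatedWave F
  rw [traceNorm_eq_tsum_abs]
  refine le_trans ?_ (ENNReal.sum_le_tsum F)
  rw [← ENNReal.ofReal_sum_of_nonneg fun i _ => re_inner_abs_nonneg A _]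
  refine ENNReal.ofReal_le_ofReal ?_
  rw [inv_mul_le_iff₀ (by positivity)]
  have hI : Integrable (fun θ => inner ℂ (truncatedWave F θ) (CFC.abs A (truncatedWave F θ)))
      (volume.restrict (torusBox n)) :=
    (hΩ.inner ((CFC.abs A).continuous.comp hΩ)).integrableOn_Icc
  -- The partial trace of `|A|` over `F` is an average of its plane-wave expectations, each of which
  -- dominates the modulus of that of `A`.
  have h1 : ∫ θ in torusBox n,
      (inner ℂ (truncatedWave F θ) (CFC.abs A (truncatedWave F θ))).re =
      (2 * Real.pi) ^ n * ∑ i ∈ F, (inner ℂ (ket _ i) (CFC.abs A (ket _ i))).re := by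
    have h2 := congrArg Complex.re (integral_inner_truncatedWave F (CFC.abs A))
    have h3 : (2 * (Real.pi : ℂ)) ^ n = (((2 * Real.pi) ^ n : ℝ) : ℂ) := by push_cast; rfl
    rw [h3, Complex.re_ofReal_mul, Complex.re_sum] at h2
    exact (integral_re hI).trans h2
  rw [← h1]
  exact integral_mono (hΩ.inner (A.continuous.comp hΩ)).norm.integrableOn_Icc hI.re
    fun θ => norm_inner_le_re_inner_abs hA _

/-! ### Uniform superpositions -/

/-- The Fock states with fewer than `N` photons in every mode. -/
def fockCube (n N : ℕ) : Finset (Fin n → ℕ) := Fintype.piFinset fun _ => Finset.range N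

lemma card_fockCube (n N : ℕ) : (fockCube n N).card = N ^ n := by
  simp [fockCube]

/-- The uniform superposition of the Fock states with fewer than `N` photons in every mode. -/
noncomputable def uniformState (n N : ℕ) : Modes n :=
  (((√((N : ℝ) ^ n))⁻¹ : ℝ) : ℂ) • ∑ m ∈ fockCube n N, ket _ m

lemma norm_uniformState {N : ℕ} (hN : 0 < N) : ‖uniformState n N‖ = 1 := by
  have h1 : ‖∑ m ∈ fockCube n N, ket _ m‖ ^ 2 = (N : ℝ) ^ n := by
    have h := (ket (Fin n → ℕ)).orthonormal.inner_sum (fun _ => (1 : ℂ)) (fun _ => (1 : ℂ))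
      (fockCube n N)
    simp only [one_smul, map_one, mul_one, Finset.sum_const, card_fockCube] at h
    rw [@norm_sq_eq_re_inner ℂ, h]
    rw [nsmul_eq_mul, mul_one, RCLike.re_to_complex, Complex.natCast_re, Nat.cast_pow]
  have hN' : (0 : ℝ) < (N : ℝ) ^ n := by positivity
  rw [uniformState, norm_smul, Complex.norm_real, Real.norm_eq_abs, abs_of_nonneg (by positivity),
    ← h1, Real.sqrt_sq (norm_nonneg _)]
  refine inv_mul_cancel₀ fun h0 => ?_
  rw [h0] at h1
  norm_num at h1
  exact hN'.ne h1

lemma repr_uniformState {N : ℕ} {m : Fin n → ℕ} (hm : m ∈ fockCube n N) :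
    (ket _).repr (uniformState n N) m = (((√((N : ℝ) ^ n))⁻¹ : ℝ) : ℂ) := by
  rw [HilbertBasis.repr_apply_apply, uniformState, inner_smul_right, inner_sum,
    Finset.sum_eq_single_of_mem m hm, orthonormal_iff_ite.1 (ket _).orthonormal, if_pos rfl, mul_one]
  intro j _ hj
  rw [orthonormal_iff_ite.1 (ket _).orthonormal, if_neg hj.symm]

/-- The terms of the Fourier series of `2π p_γ` at `x`. -/
noncomputable def fourierTerm (γ x : ℝ) (m : ℤ) : ℂ :=
  (gaussCoeff γ m : ℂ) * Complex.exp (((x * m : ℝ) : ℂ) * Complex.I)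

end Torus

/-! ### Convergence of the measured densities -/

section Difference

variable {n : ℕ} {γ₁ γ₂ : ℝ}

/-- All entries of the uniform state on the cube equal `N^{-n}`, so the quadratic form is a double
sum over a product set of a product over modes. It splits into one Toeplitz sum, with one factor
`N⁻¹`, per mode. -/
lemma inner_truncatedWave_uniformState (hγ₁ : 0 < γ₁) (hγ₂ : 0 < γ₂) (q₁ q₂ : ℝ) (N : ℕ)
    (θ : Fin n → ℝ) :
    inner ℂ (truncatedWave (fockCube n N) θ)
      (((q₁ : ℂ) • dephasingPow n γ₁
          (InnerProductSpace.rankOne ℂ (uniformState n N) (uniformState n N)) -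
        (q₂ : ℂ) • dephasingPow n γ₂
          (InnerProductSpace.rankOne ℂ (uniformState n N) (uniformState n N)))
        (truncatedWave (fockCube n N) θ)) =
      q₁ * ∏ k, fejerSum (fourierTerm γ₁ (θ k)) N -
        q₂ * ∏ k, fejerSum (fourierTerm γ₂ (θ k)) N := by
  have hone : ∀ {γ : ℝ}, 0 < γ → inner ℂ (truncatedWave (fockCube n N) θ)
      (dephasingPow n γ (InnerProductSpace.rankOne ℂ (uniformState n N) (uniformState n N))
        (truncatedWave (fockCube n N) θ)) = ∏ k, fejerSum (fourierTerm γ (θ k)) N := by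
    intro γ hγ
    have hw : (((√((N : ℝ) ^ n))⁻¹ : ℝ) : ℂ) * (((√((N : ℝ) ^ n))⁻¹ : ℝ) : ℂ) =
        (N : ℂ)⁻¹ ^ n := by
      rw [← Complex.ofReal_mul, ← mul_inv, Real.mul_self_sqrt (by positivity)]
      push_cast
      rw [inv_pow]
    -- The phase carries `a - b` and the coefficient `b - a`; evenness of `gaussCoeff` reconciles
    -- them.
    have hterm : ∀ a b : ℕ, ∀ k, Complex.exp (((θ k * a - θ k * b : ℝ) : ℂ) * Complex.I) *
        (gaussCoeff γ ((b : ℤ) - a) : ℂ) = fourierTerm γ (θ k) ((a : ℤ) - b) := by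
      intro a b k
      rw [fourierTerm, ← gaussCoeff_neg, neg_sub, mul_comm, ← mul_sub]
      push_cast
      rfl
    have hprod : ∏ k, ∑ a ∈ Finset.range N, ∑ b ∈ Finset.range N,
        fourierTerm γ (θ k) ((a : ℤ) - b) = ∑ i ∈ fockCube n N, ∑ j ∈ fockCube n N,
          ∏ k, fourierTerm γ (θ k) ((i k : ℤ) - j k) := by
      rw [fockCube, Finset.prod_univ_sum]
      exact Finset.sum_congr rfl fun i _ => Finset.prod_univ_sum _ _
    simp only [fejerSum]
    rw [inner_truncatedWave, Finset.prod_mul_distrib, Finset.prod_const, Finset.card_univ,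
      Fintype.card_fin, hprod, Finset.mul_sum]
    refine Finset.sum_congr rfl fun i hi => ?_
    rw [Finset.mul_sum]
    refine Finset.sum_congr rfl fun j hj => ?_
    rw [inner_dephasingPow_rankOne n hγ, repr_uniformState hi, repr_uniformState hj,
      Complex.conj_ofReal, hw, ← mul_assoc, mul_comm]
    simp_rw [← hterm]
    rw [Finset.prod_mul_distrib, ← Complex.exp_sum, ← Finset.sum_mul, ← Finset.sum_sub_distrib]
    push_cast
    rfl
  rw [_root_.sub_apply, _root_.smul_apply, _root_.smul_apply, inner_sub_right, inner_smul_right,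
    inner_smul_right, hone hγ₁, hone hγ₂]

lemma norm_fejerSum_fourierTerm_le {γ : ℝ} (hγ : 0 < γ) (x : ℝ) (N : ℕ) :
    ‖fejerSum (fourierTerm γ x) N‖ ≤ ∑' m, gaussCoeff γ m :=
  norm_fejerSum_le (summable_gaussCoeff hγ) (fun m => (norm_gaussCoeff_mul_exp γ x m).le) N

lemma continuous_fejerSum_fourierTerm (γ : ℝ) (N : ℕ) :
    Continuous fun x => fejerSum (fourierTerm γ x) N := by
  unfold fejerSum fourierTerm
  fun_prop

lemma tendsto_integral_norm_fejerSum (hγ₁ : 0 < γ₁) (hγ₂ : 0 < γ₂) (q₁ q₂ : ℝ) :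
    Tendsto (fun N : ℕ => ((2 * Real.pi) ^ n)⁻¹ * ∫ θ in torusBox n,
      ‖q₁ * ∏ k, fejerSum (fourierTerm γ₁ (θ k)) N -
        q₂ * ∏ k, fejerSum (fourierTerm γ₂ (θ k)) N‖) atTop
      (𝓝 (∫ θ in torusBox n, |signedDensity n γ₁ γ₂ q₁ q₂ θ|)) := by
  have hlim : ∀ {γ : ℝ}, 0 < γ → ∀ θ : Fin n → ℝ,
      Tendsto (fun N => ∏ k, fejerSum (fourierTerm γ (θ k)) N) atTop
        (𝓝 ((2 * Real.pi) ^ n * ((∏ k, wrappedNormal γ (θ k) : ℝ) : ℂ))) := by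
    intro γ hγ θ
    have h := tendsto_finsetProd (Finset.univ : Finset (Fin n)) fun k _ =>
      tendsto_fejerSum (c := fourierTerm γ (θ k)) (summable_gaussCoeff_mul_exp hγ (θ k))
    have h2 : ∀ k, ∑' m, fourierTerm γ (θ k) m = 2 * Real.pi * (wrappedNormal γ (θ k) : ℂ) :=
      fun k => tsum_gaussCoeff_mul_exp hγ (θ k)
    simp_rw [h2] at h
    rw [Finset.prod_mul_distrib, Finset.prod_const, Finset.card_univ, Fintype.card_fin] at h
    push_cast
    exact h
  have hbd : ∀ {γ : ℝ}, 0 < γ → ∀ (q : ℝ) (θ : Fin n → ℝ) (N : ℕ),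
      ‖q * ∏ k, fejerSum (fourierTerm γ (θ k)) N‖ ≤ |q| * (∑' m, gaussCoeff γ m) ^ n := by
    intro γ hγ q θ N
    rw [norm_mul, Complex.norm_real, Real.norm_eq_abs, norm_prod]
    refine mul_le_mul_of_nonneg_left ?_ (abs_nonneg q)
    refine (Finset.prod_le_prod (fun k _ => norm_nonneg _)
      fun k _ => norm_fejerSum_fourierTerm_le hγ (θ k) N).trans ?_
    simp
  have hcont : ∀ (γ : ℝ) (N : ℕ),
      Continuous fun θ : Fin n → ℝ => ∏ k, fejerSum (fourierTerm γ (θ k)) N := fun γ N =>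
    continuous_finsetProd _ fun k _ =>
      (continuous_fejerSum_fourierTerm γ N).comp (continuous_apply k)
  have hT : Tendsto (fun N : ℕ => ∫ θ in torusBox n,
      ‖q₁ * ∏ k, fejerSum (fourierTerm γ₁ (θ k)) N -
        q₂ * ∏ k, fejerSum (fourierTerm γ₂ (θ k)) N‖) atTop
      (𝓝 (∫ θ in torusBox n, (2 * Real.pi) ^ n * |signedDensity n γ₁ γ₂ q₁ q₂ θ|)) := by
    -- The dominating function is constant, hence integrable on the compact cube.
    refine tendsto_integral_of_dominated_convergence
      (fun _ => |q₁| * (∑' m, gaussCoeff γ₁ m) ^ n + |q₂| * (∑' m, gaussCoeff γ₂ m) ^ n)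
      (fun N => ?_) ?_ (fun N => Eventually.of_forall fun θ => ?_)
      (Eventually.of_forall fun θ => ?_)
    · exact ((continuous_const.mul (hcont γ₁ N)).sub
        (continuous_const.mul (hcont γ₂ N))).norm.aestronglyMeasurable
    · exact continuous_const.integrableOn_Icc
    · rw [norm_norm]
      exact (norm_sub_le _ _).trans (add_le_add (hbd hγ₁ q₁ θ N) (hbd hγ₂ q₂ θ N))
    · have h := (((hlim hγ₁ θ).const_mul (q₁ : ℂ)).sub ((hlim hγ₂ θ).const_mul (q₂ : ℂ))).norm
      convert h using 2
      have : (q₁ : ℂ) * ((2 * Real.pi) ^ n * ((∏ k, wrappedNormal γ₁ (θ k) : ℝ) : ℂ)) -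
          q₂ * ((2 * Real.pi) ^ n * ((∏ k, wrappedNormal γ₂ (θ k) : ℝ) : ℂ)) =
          (((2 * Real.pi) ^ n * signedDensity n γ₁ γ₂ q₁ q₂ θ : ℝ) : ℂ) := by
        rw [signedDensity]
        push_cast
        ring
      rw [this, Complex.norm_real, Real.norm_eq_abs, abs_mul,
        abs_of_pos (show (0 : ℝ) < (2 * Real.pi) ^ n by positivity)]
  have h := hT.const_mul ((2 * Real.pi) ^ n)⁻¹
  rwa [integral_const_mul, inv_mul_cancel_left₀ (by positivity)] at h

end Difference

end Dephasing

theorem theorem6 (n : ℕ) (γ₁ γ₂ q₁ q₂ : ℝ) (hγ₁ : 0 < γ₁) (hγ₂ : 0 < γ₂)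
    (hq₁ : 0 ≤ q₁) (hq₂ : 0 ≤ q₂) (hq : q₁ + q₂ = 1) :
    IsLUB
      {x : ENNReal | ∃ ρ ∈ Dephasing.pureStates (Fin n → ℕ),
        x = Dephasing.traceNorm
          ((q₁ : ℂ) • Dephasing.dephasingPow n γ₁ ρ - (q₂ : ℂ) • Dephasing.dephasingPow n γ₂ ρ)}
      (ENNReal.ofReal
        (∫ θ in Set.Icc (fun _ : Fin n => -Real.pi) (fun _ : Fin n => Real.pi),
          |q₁ * ∏ k, Dephasing.wrappedNormal γ₁ (θ k)
            - q₂ * ∏ k, Dephasing.wrappedNormal γ₂ (θ k)|)) := by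
  constructor
  · rintro _ ⟨_, ⟨ψ, hψ, rfl⟩, rfl⟩
    exact Dephasing.traceNorm_dephasingPow_sub_le hγ₁ hγ₂ q₁ q₂ hψ
  · intro b hb
    -- The uniform states form an approximating sequence, so an upper bound for their trace norms
    -- passes to the limit; `N > 0` makes them unit vectors.
    refine le_of_tendsto ((ENNReal.continuous_ofReal.tendsto _).comp
      (Dephasing.tendsto_integral_norm_fejerSum (n := n) hγ₁ hγ₂ q₁ q₂)) ?_
    filter_upwards [Filter.eventually_gt_atTop 0] with N hN
    refine le_trans ?_ (hb ⟨_, ⟨Dephasing.uniformState n N, Dephasing.norm_uniformState hN, rfl⟩,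
      rfl⟩)
    have h := Dephasing.le_traceNorm_truncatedWave
      (Dephasing.isSelfAdjoint_dephasingPow_sub hγ₁ hγ₂ q₁ q₂ (Dephasing.uniformState n N))
      (Dephasing.fockCube n N)
    simp_rw [Dephasing.inner_truncatedWave_uniformState hγ₁ hγ₂] at h
    exact h
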